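/- **Model.** Let $Y_0,Y_1,Y_2,\dots$ be i.i.d. real random variables (transmission delays) with $\Pr(Y_j\in[B_L,B_U])=1$, $B_L>0$. Let $g:[0,\infty)\to[0,\infty)$ be continuous and nondecreasing, let $T>4B_U$, and let $M<\infty$ with $M\ge T-B_U$. Put $D_0=0$, $R_0=-Y_0$, and for $j\ge 0$ let $R_{j+1}=D_j+Z_j$ (request point) and $D_{j+1}=R_{j+1}+Y_{j+1}$ (delivery point). A *causal policy* (set $\Pi$) is a sequence $(Z_j)_{j\ge0}$ of random waiting times in $[0,M]$ such that, for every $j$, $Y_{j+1}$ is independent of $(Y_i,Z_i)_{i\le j}$ (so randomization is allowed). The age is $\Delta(t)=t-\max\{R_j: D_j\le t\}$. The single query value and the query average value for the periodic queries $Q_k=kT$, $k\ge1$, are $$\bar h^{\rm one}_{\rm opt}(Q)=\inf_{\pi\in\Pi}E[g(\Delta(Q))],\qquad \bar h_{\rm opt}=\inf_{\pi\in\Pi}\limsup_{n\to\infty}\frac1n\sum_{k=1}^nE[g(\Delta(Q_k))].$$ **Border point policies.** For a measurable $z:[0,\infty)\times[0,\infty)\to[0,M]$ let $G_R^z(r,a)$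 be the expected penalty at a query if an update is requested a time $r$ before the query, the age at the request is $a$, and afterwards $z$ is applied, that is, $Z_j=z(Y_j,Q-D_j)$. Put $\beta=3B_U-z(B_L,3B_U)$; the *border point* of a query $Q$ is $Q^{BP}=Q-\beta$, the request point that $z$ chooses at the delivery point $Q-3B_U$ with age $B_L$. Call $z$ a *border point policy* if 1. $z(y,q)\le q$ for $q>0$ (no request is postponed beyond the query); 2. for all $q>0$, $y\ge0$, from a delivery point at a time $q$ before the query with age $y$, the policy $z$ minimizes the expected penalty at the query among all causal policies; 3. $\beta\ge B_U$, and $G_R^z(\beta,a)\le G_R^z(r,a')$ for all $r\ge B_U$ and $a,a'\ge0$; 4. $z$ waits until the border point: $z(y,q)=q-\beta$ for all $y\ge 0$ and all $q>3B_U$ with $q-\beta\le M$. **Claim.** A border point policy exists. Let $z$ be any border point policy. Then for each $Q>0$ the policy $Z_j=z(Y_j,Q-D_j)$ belongs to $\Pi$ and attains $\bar h^{\rm one}_{\rm opt}(Q)$. Let $\pi^{\rm opt}$ be the policy that employs $z$ repeatedly, query after query: at the delivery point $D_j$ it takes $Z_j=z(Y_j,Q_k-D_j)$, where $Q_k$ is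 the first query strictly after $D_j$. Then $\pi^{\rm opt}\in\Pi$; it is optimal for the periodic queries, i.e. its query average penalty equals $\bar h_{\rm opt}$; moreover $\bar h_{\rm opt}=\bar h^{\rm one}_{\rm opt}(Q)$ for every $Q>3B_U$; and $\pi^{\rm opt}$ is stationary and deterministic: almost surely, for all $j\ge0$, $$Z_j=z(Y_j,A_j),\qquad A_j=T-\Big(D_j-T\Big\lfloor\frac{D_j}{T}\Big\rfloor\Big),$$ where $A_j$ is the time remaining at $D_j$ until the next query. -/

import Mathlib

open MeasureTheory ProbabilityTheory Filter
open scoped ENNReal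

noncomputable section

namespace PullOrWait

variable {Ω : Type*}

/-! ### Sample paths: request points, delivery points and age of information -/

/-- Delivery points: `D 0 = 0` and `D (j+1) = R (j+1) + Y (j+1)` with `R (j+1) = D j + Z j`. Here
`Y j` are the transmission delays and `Z j` the waiting times. -/
def delivery (Y Z : ℕ → Ω → ℝ) : ℕ → Ω → ℝ
  | 0, _ => 0
  | j + 1, ω => delivery Y Z j ω + Z j ω + Y (j + 1) ω

/-- Request points: `R 0 = D 0 - Y 0` and `R (j+1) = D j + Z j`. -/
def request (Y Z : ℕ → Ω → ℝ) : ℕ → Ω → ℝ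
  | 0, ω => -Y 0 ω
  | j + 1, ω => delivery Y Z j ω + Z j ω

/-- Age of information `Δ(t) = t - U(t)` with `U(t) = max {R j | D j ≤ t}`. -/
def age (Y Z : ℕ → Ω → ℝ) (t : ℝ) (ω : Ω) : ℝ :=
  t - sSup {r : ℝ | ∃ j : ℕ, delivery Y Z j ω ≤ t ∧ r = request Y Z j ω}

/-! ### Causal update policies -/

/-- The information available when `Z j` has been chosen: the delays and the waiting times with
indices at most `j`. -/
abbrev history (Y Z : ℕ → Ω → ℝ) (j : ℕ) : MeasurableSpace Ω :=
  ⨆ i ≤ j, MeasurableSpace.comap (Y i) (borel ℝ) ⊔ MeasurableSpace.comap (Z i) (borel ℝ)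

variable [MeasurableSpace Ω]

/-- A causal update policy: waiting times in `[0, M]` that do not anticipate the delays that are
not yet observed. Exogenous randomization is allowed. -/
structure IsCausal (P : Measure Ω) (Y : ℕ → Ω → ℝ) (M : ℝ) (Z : ℕ → Ω → ℝ) : Prop where
  measurable : ∀ j, Measurable (Z j)
  mem_Icc : ∀ j ω, Z j ω ∈ Set.Icc 0 M
  nonanticipating : ∀ j,
    Indep (history Y Z j) (MeasurableSpace.comap (Y (j + 1)) (borel ℝ)) P

/-! ### The two optimization problems -/

/-- Expected age penalty `E[g(Δ(t))]` at time `t`. -/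
def expectedPenalty (P : Measure Ω) (g : ℝ → ℝ) (Y Z : ℕ → Ω → ℝ) (t : ℝ) : ℝ≥0∞ :=
  ∫⁻ ω, ENNReal.ofReal (g (age Y Z t ω)) ∂P

/-- Optimal value of the single query problem with query time `Q`. -/
def singleQueryOpt (P : Measure Ω) (g : ℝ → ℝ) (Y : ℕ → Ω → ℝ) (M Q : ℝ) : ℝ≥0∞ :=
  ⨅ (Z : ℕ → Ω → ℝ) (_ : IsCausal P Y M Z), expectedPenalty P g Y Z Q

/-- Query average age penalty of a policy for the queries `Q k = k T`, `k ≥ 1`. -/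
def queryAverage (P : Measure Ω) (g : ℝ → ℝ) (Y Z : ℕ → Ω → ℝ) (T : ℝ) : ℝ≥0∞ :=
  limsup (fun n : ℕ => (∑ k ∈ Finset.Icc 1 n, expectedPenalty P g Y Z (k * T)) / (n : ℝ≥0∞)) atTop

/-- Optimal query average age penalty for the queries `Q k = k T`, `k ≥ 1`. -/
def periodicOpt (P : Measure Ω) (g : ℝ → ℝ) (Y : ℕ → Ω → ℝ) (M T : ℝ) : ℝ≥0∞ :=
  ⨅ (Z : ℕ → Ω → ℝ) (_ : IsCausal P Y M Z), queryAverage P g Y Z T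

/-! ### Policies given by feedback rules -/

/-- Delivery points of the policy that, at the delivery point `d` of update `j` with delay `y`,
waits for the time `φ j y d`. -/
def ruleDelivery {Ω : Type*} (φ : ℕ → ℝ → ℝ → ℝ) (Y : ℕ → Ω → ℝ) : ℕ → Ω → ℝ
  | 0, _ => 0
  | j + 1, ω => ruleDelivery φ Y j ω + φ j (Y j ω) (ruleDelivery φ Y j ω) + Y (j + 1) ω

/-- The waiting times of the policy given by the rule `φ`. -/
def rulePolicy {Ω : Type*} (φ : ℕ → ℝ → ℝ → ℝ) (Y : ℕ → Ω → ℝ) (j : ℕ) (ω : Ω) : ℝ :=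
  φ j (Y j ω) (ruleDelivery φ Y j ω)

/-- The stationary deterministic policy for a single query at `Q` with decision function `z`:
`Z j = z (Y j) (Q - D j)`. -/
def singleQueryPolicy {Ω : Type*} (z : ℝ → ℝ → ℝ) (Q : ℝ) (Y : ℕ → Ω → ℝ) : ℕ → Ω → ℝ :=
  rulePolicy (fun _ y d => z y (Q - d)) Y

/-- The delay process when the age at the initial delivery point is known to be `y`. -/
def withInitialAge {Ω : Type*} (y : ℝ) (Y : ℕ → Ω → ℝ) : ℕ → Ω → ℝ :=
  Function.update Y 0 (fun _ => y)

/-- `G_D`: expected penalty at the query if an update is delivered a time `q` before the query, the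
age at that delivery point is `y`, and the decision function `z` is applied. -/
def deliveryValue (P : Measure Ω) (g : ℝ → ℝ) (Y : ℕ → Ω → ℝ) (z : ℝ → ℝ → ℝ) (q y : ℝ) : ℝ≥0∞ :=
  expectedPenalty P g (withInitialAge y Y) (singleQueryPolicy z q (withInitialAge y Y)) q

/-- `G_R`: expected penalty at the query if an update is requested a time `r` before the query, the
age at that request point is `a`, and the decision function `z` is applied afterwards. -/
def requestValue (P : Measure Ω) (g : ℝ → ℝ) (Y : ℕ → Ω → ℝ) (z : ℝ → ℝ → ℝ) (r a : ℝ) : ℝ≥0∞ :=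
  expectedPenalty P g (withInitialAge a Y)
    (rulePolicy (fun j y d => if j = 0 then 0 else z y (r - d)) (withInitialAge a Y)) r

/-- Distance from the border point to the query. The border point is the request point chosen by
`z` at the delivery point `Q - 3 B_U` with age `B_L`, so this is `Q - (Q - 3 B_U + z B_L (3 B_U))`. -/
def borderDistance (z : ℝ → ℝ → ℝ) (B_L B_U : ℝ) : ℝ :=
  3 * B_U - z B_L (3 * B_U)

/-- `z` is the decision function of a deterministic optimal policy for the single query problem
that waits until the border point. -/
structure IsBorderPointPolicy (P : Measure Ω) (g : ℝ → ℝ) (Y : ℕ → Ω → ℝ) (B_L B_U M : ℝ)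
    (z : ℝ → ℝ → ℝ) : Prop where
  measurable : Measurable (Function.uncurry z)
  mem_Icc : ∀ y q, z y q ∈ Set.Icc 0 M
  /-- No request is postponed beyond the query. -/
  le_query : ∀ y q, 0 ≤ y → 0 < q → z y q ≤ q
  /-- At every delivery point before the query, whatever the age there, `z` is optimal among all
  causal continuations. -/
  optimal : ∀ y q, 0 ≤ y → 0 < q →
    deliveryValue P g Y z q y = singleQueryOpt P g (withInitialAge y Y) M q
  /-- The border point is at least `B_U` before the query... -/
  le_border : B_U ≤ borderDistance z B_L B_U
  /-- ... and is a best request point among all those, whatever the ages at the request points. -/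
  border : ∀ r a a', B_U ≤ r → 0 ≤ a → 0 ≤ a' →
    requestValue P g Y z (borderDistance z B_L B_U) a ≤ requestValue P g Y z r a'
  /-- From every delivery point earlier than `3 B_U` before the query, `z` waits until the border
  point, if the bound `M` on the waiting times permits it. -/
  wait_border : ∀ y q, 0 ≤ y → 3 * B_U < q → q - borderDistance z B_L B_U ≤ M →
    z y q = q - borderDistance z B_L B_U

/-! ### Periodic queries -/

/-- The first query strictly after time `d`, among the queries `k T`, `k ≥ 1`. -/
def nextQuery (T d : ℝ) : ℝ :=
  ((sInf {k : ℕ | 1 ≤ k ∧ d < k * T} : ℕ) : ℝ) * T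

/-- The policy for periodic queries that employs the single query policy with decision function
`z` repeatedly: at every delivery point it acts as that policy does for the query that comes next,
starting anew at each query. -/
def periodicPolicy {Ω : Type*} (z : ℝ → ℝ → ℝ) (T : ℝ) (Y : ℕ → Ω → ℝ) : ℕ → Ω → ℝ :=
  rulePolicy (fun _ y d => z y (nextQuery T d - d)) Y

/-- The time `A j` remaining at the delivery point `D j` until the next query. -/
def remaining {Ω : Type*} (T : ℝ) (Y Z : ℕ → Ω → ℝ) (j : ℕ) (ω : Ω) : ℝ :=
  T - (delivery Y Z j ω - T * ⌊delivery Y Z j ω / T⌋)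

/-- `Z` is a stationary and deterministic policy for the queries `k T` with decision function `ζ`:
`Z j = ζ (Y j) (A j)` for all `j`. -/
structure IsStationaryDeterministic (P : Measure Ω) (Y : ℕ → Ω → ℝ) (M T : ℝ) (Z : ℕ → Ω → ℝ)
    (ζ : ℝ → ℝ → ℝ) : Prop where
  measurable : Measurable (Function.uncurry ζ)
  mem_Icc : ∀ y a, ζ y a ∈ Set.Icc 0 M
  eq_decision : ∀ᵐ ω ∂P, ∀ j, Z j ω = ζ (Y j ω) (remaining T Y Z j ω)

end PullOrWait

end

open Topology

noncomputable section

namespace PullOrWait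

/-! ### The Bellman operator

The state before a query is a pair `(q, x)`, where `q` is the time left until the query and `x` is
the age at the query if nothing more is delivered before it. -/

/-! Causality makes the next delay independent of the state, so one step of any causal policy is
governed by the Bellman operator. Delays are at least `B_L > 0`, hence only boundedly many
deliveries precede the query, value iteration becomes stationary for bounded `q`, and its limit
`value` solves the Bellman equation; lower semicontinuity supplies minimizers. Along a causal policy
the expected value of the state never decreases (`stateValue_monotone`), and it stays constant if
every decision attains the Bellman minimum (`expectedPenalty_eq_of_optimal`). So `value` is the
optimal penalty of a single query.

The periodic problem rests on flatness far from the query. A request at least `B_U` before the query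
is delivered in time and erases the old age. A later request, if the old age is large enough, is no
better than one made `B_U` earlier, after whose delivery one can still wait for the original request
point (`requestCost_add_le`). Let `c` be the least cost of a request made between `B_U` and `2 *
B_U` before the query (`farValue`). Then `value` equals `c` at all delivery points at least `2 *
B_U` before the query (`value_eq_farValue`), and every request at least `3 * B_U` before it costs
`c` (`requestCost_eq_farValue`).

Now take the query `k T` under the repeated policy. If `k T` is the next query, the decision is
optimal by construction. If an earlier query comes first, the request is made no later than that
one, so at least `T > 4 * B_U` before `k T`; it costs `c` and is optimal as well. One policy is thus
optimal for all queries at once, with penalty `c` at each, and no causal policy gets below `c` at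
any of them. -/

/-- Expected continuation value of a request a time `r` before the query in state `x`, if `U` is
the value at the next delivery point. -/
def requestCost (μ : Measure ℝ) (U : ℝ → ℝ → ℝ≥0∞) (r x : ℝ) : ℝ≥0∞ :=
  ∫⁻ y, U (r - y) (if y ≤ r then min x r else x) ∂μ

/-- The Bellman operator at a delivery point. -/
def bellman (μ : Measure ℝ) (M : ℝ) (U : ℝ → ℝ → ℝ≥0∞) (q x : ℝ) : ℝ≥0∞ :=
  ⨅ w ∈ Set.Icc 0 M, requestCost μ U (q - w) x

/-- Lower semicontinuous functions of the state that are monotone in the age. -/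
structure IsRegular (U : ℝ → ℝ → ℝ≥0∞) : Prop where
  lsc : LowerSemicontinuous (Function.uncurry U)
  mono : ∀ q, Monotone (U q)

/-! ### Semicontinuity of infima over compact sets and of integrals. -/

theorem lowerSemicontinuous_biInf_of_isCompact {X : Type*} [TopologicalSpace X] {K : Set ℝ}
    (hK : IsCompact K) {F : X × ℝ → ℝ≥0∞} (hF : LowerSemicontinuous F) :
    LowerSemicontinuous fun a => ⨅ w ∈ K, F (a, w) := by
  intro a c hc
  obtain ⟨c', hcc', hc'⟩ := exists_between hc
  have h := hK.eventually_forall_of_forall_eventually (x₀ := a) (P := fun b w => c' < F (b, w))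
    fun w hw => hF (a, w) c' (hc'.trans_le (iInf₂_le w hw))
  filter_upwards [h] with b hb
  exact hcc'.trans_le (le_iInf₂ fun w hw => (hb w hw).le)

theorem exists_eq_biInf_of_isCompact {K : Set ℝ} (hK : IsCompact K) (hne : K.Nonempty)
    {f : ℝ → ℝ≥0∞} (hf : LowerSemicontinuous f) : ∃ w ∈ K, f w = ⨅ v ∈ K, f v := by
  obtain ⟨w, hw, hmin⟩ := LowerSemicontinuousOn.exists_isMinOn hne hK
    (hf.lowerSemicontinuousOn K)
  exact ⟨w, hw, le_antisymm (le_iInf₂ fun v hv => hmin hv) (iInf₂_le w hw)⟩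

/-- Fatou's lemma; first countability makes the neighbourhood filter countably generated, as Fatou
requires. -/
theorem lowerSemicontinuous_lintegral_of_forall {X : Type*} [TopologicalSpace X]
    [FirstCountableTopology X] {μ : Measure ℝ} {f : X → ℝ → ℝ≥0∞}
    (hm : ∀ a, Measurable (f a)) (hf : ∀ y, LowerSemicontinuous fun a => f a y) :
    LowerSemicontinuous fun a => ∫⁻ y, f a y ∂μ := by
  rw [lowerSemicontinuous_iff_le_liminf]
  intro a
  calc ∫⁻ y, f a y ∂μ ≤ ∫⁻ y, liminf (fun b => f b y) (𝓝 a) ∂μ :=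
        lintegral_mono fun y => (lowerSemicontinuous_iff_le_liminf.1 (hf y)) a
    _ ≤ _ := lintegral_liminf_le hm

namespace IsRegular

variable {μ : Measure ℝ} {M : ℝ} {U : ℝ → ℝ → ℝ≥0∞}

theorem measurable_comp {α : Type*} [MeasurableSpace α] (hU : IsRegular U) {f g : α → ℝ}
    (hf : Measurable f) (hg : Measurable g) : Measurable fun a => U (f a) (g a) :=
  hU.lsc.measurable.comp (hf.prodMk hg)

theorem measurable_ite (hU : IsRegular U) :
    Measurable fun p : (ℝ × ℝ) × ℝ =>
      U (p.1.1 - p.2) (if p.2 ≤ p.1.1 then min p.1.2 p.1.1 else p.1.2) := by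
  refine hU.measurable_comp (by fun_prop) (Measurable.ite ?_ (by fun_prop) (by fun_prop))
  exact measurableSet_le (by fun_prop) (by fun_prop)

/-- The age jumps where the delivery meets the query, `y = r`. There the branch taken is the smaller
one, so monotonicity in the age keeps lower semicontinuity. -/
theorem lowerSemicontinuous_ite (hU : IsRegular U) (y : ℝ) :
    LowerSemicontinuous fun p : ℝ × ℝ =>
      U (p.1 - y) (if y ≤ p.1 then min p.2 p.1 else p.2) := by
  rintro ⟨r, x⟩ c hc
  dsimp only at hc
  by_cases h : y ≤ r
  · rw [if_pos h] at hc
    have hcont : Continuous fun p : ℝ × ℝ => (p.1 - y, min p.2 p.1) := by fun_prop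
    filter_upwards [hcont.continuousAt.eventually (hU.lsc (r - y, min x r) c hc)] with p hp
    refine lt_of_lt_of_le hp (hU.mono _ ?_)
    dsimp only
    split_ifs
    · exact le_rfl
    · exact min_le_left _ _
  · rw [if_neg h] at hc
    have hcont : Continuous fun p : ℝ × ℝ => (p.1 - y, p.2) := by fun_prop
    have hlt : ∀ᶠ p : ℝ × ℝ in 𝓝 (r, x), p.1 < y :=
      continuous_fst.continuousAt.eventually (gt_mem_nhds (not_le.1 h))
    filter_upwards [hcont.continuousAt.eventually (hU.lsc (r - y, x) c hc), hlt] with p hp hpy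
    rwa [if_neg (not_le.2 hpy)]

theorem requestCost (hU : IsRegular U) : IsRegular (requestCost μ U) where
  lsc := lowerSemicontinuous_lintegral_of_forall
    (fun a => hU.measurable_ite.comp (measurable_const.prodMk measurable_id))
    hU.lowerSemicontinuous_ite
  mono r x x' h := lintegral_mono fun y => hU.mono _ (by split_ifs <;> gcongr)

theorem bellman (hU : IsRegular U) : IsRegular (bellman μ M U) where
  lsc := by
    have hcont : Continuous fun p : (ℝ × ℝ) × ℝ => (p.1.1 - p.2, p.1.2) := by fun_prop
    exact lowerSemicontinuous_biInf_of_isCompact isCompact_Icc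
      ((hU.requestCost (μ := μ)).lsc.comp hcont)
  mono q x x' h := iInf₂_mono fun w _ => hU.requestCost.mono _ h

theorem exists_eq_bellman (hU : IsRegular U) (hM : 0 ≤ M) (q x : ℝ) :
    ∃ w ∈ Set.Icc 0 M, PullOrWait.requestCost μ U (q - w) x = PullOrWait.bellman μ M U q x := by
  have hcont : Continuous fun w : ℝ => (q - w, x) := by fun_prop
  exact exists_eq_biInf_of_isCompact isCompact_Icc (Set.nonempty_Icc.2 hM)
    ((hU.requestCost (μ := μ)).lsc.comp hcont)

end IsRegular

theorem bellman_le {μ : Measure ℝ} {M : ℝ} {U : ℝ → ℝ → ℝ≥0∞} {w : ℝ} (hw : w ∈ Set.Icc 0 M)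
    (q x : ℝ) : bellman μ M U q x ≤ requestCost μ U (q - w) x :=
  iInf₂_le w hw

theorem bellman_mono {μ : Measure ℝ} {M : ℝ} {U V : ℝ → ℝ → ℝ≥0∞} (h : ∀ q x, U q x ≤ V q x)
    (q x : ℝ) : bellman μ M U q x ≤ bellman μ M V q x :=
  iInf₂_mono fun _ _ => lintegral_mono fun _ => h _ _

/-! ### The value function -/

/-- Value iteration with penalty `γ`, started from the trivial lower bound. -/
def valueIter (μ : Measure ℝ) (γ : ℝ → ℝ≥0∞) (M : ℝ) : ℕ → ℝ → ℝ → ℝ≥0∞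
  | 0, q, x => if q < 0 then γ x else 0
  | n + 1, q, x => bellman μ M (valueIter μ γ M n) q x

/-- Optimal expected penalty from a delivery point in the state `(q, x)`. -/
def value (μ : Measure ℝ) (γ : ℝ → ℝ≥0∞) (M q x : ℝ) : ℝ≥0∞ :=
  ⨆ n, valueIter μ γ M n q x

/-- Standing assumptions on the delay distribution, the penalty and the bound on waiting times. -/
structure IsModel (μ : Measure ℝ) (γ : ℝ → ℝ≥0∞) (B_L B_U M : ℝ) : Prop where
  prob : IsProbabilityMeasure μ
  pos : 0 < B_L
  supp : ∀ᵐ y ∂μ, y ∈ Set.Icc B_L B_U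
  cont : Continuous γ
  mono : Monotone γ
  le_bound : 3 * B_U ≤ M

namespace IsModel

variable {μ : Measure ℝ} {γ : ℝ → ℝ≥0∞} {B_L B_U M : ℝ}

theorem le (h : IsModel μ γ B_L B_U M) : B_L ≤ B_U := by
  have := h.prob
  obtain ⟨y, hy⟩ := h.supp.exists
  exact hy.1.trans hy.2

theorem upper_pos (h : IsModel μ γ B_L B_U M) : 0 < B_U := h.pos.trans_le h.le

theorem bound_nonneg (h : IsModel μ γ B_L B_U M) : 0 ≤ M := by
  linarith [h.upper_pos, h.le_bound]

theorem requestCost_congr (h : IsModel μ γ B_L B_U M) {U V : ℝ → ℝ → ℝ≥0∞} {c r : ℝ}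
    (hUV : ∀ q x, q < c → U q x = V q x) (hr : r < c + B_L) (x : ℝ) :
    requestCost μ U r x = requestCost μ V r x := by
  refine lintegral_congr_ae ?_
  filter_upwards [h.supp] with y hy
  exact hUV _ _ (by linarith [hy.1])

theorem requestCost_of_lt (h : IsModel μ γ B_L B_U M) {U : ℝ → ℝ → ℝ≥0∞}
    (hU : ∀ q x, q < 0 → U q x = γ x) {r : ℝ} (hr : r < B_L) (x : ℝ) :
    requestCost μ U r x = γ x := by
  have := h.prob
  calc requestCost μ U r x = ∫⁻ _, γ x ∂μ := by
        refine lintegral_congr_ae ?_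
        filter_upwards [h.supp] with y hy
        rw [if_neg (by linarith [hy.1]), hU _ _ (by linarith [hy.1])]
    _ = γ x := by simp

theorem bellman_of_lt (h : IsModel μ γ B_L B_U M) {U : ℝ → ℝ → ℝ≥0∞}
    (hU : ∀ q x, q < 0 → U q x = γ x) {q : ℝ} (hq : q < B_L) (x : ℝ) :
    bellman μ M U q x = γ x := by
  refine le_antisymm ?_ (le_iInf₂ fun w hw => ?_)
  · refine (bellman_le ⟨le_rfl, h.bound_nonneg⟩ q x).trans_eq ?_
    exact h.requestCost_of_lt hU (by linarith) x
  · exact (h.requestCost_of_lt hU (by linarith [hw.1]) x).ge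

theorem valueIter_of_neg (h : IsModel μ γ B_L B_U M) (n : ℕ) :
    ∀ q x, q < 0 → valueIter μ γ M n q x = γ x := by
  induction n with
  | zero => intro q x hq; simp [valueIter, hq]
  | succ n ih => exact fun q x hq => h.bellman_of_lt ih (hq.trans h.pos) x

/-- The set `q < 0` is open and the start is `0`, the least value, off it; this gives semicontinuity
across `q = 0`. -/
theorem isRegular_valueIter (h : IsModel μ γ B_L B_U M) (n : ℕ) :
    IsRegular (valueIter μ γ M n) := by
  induction n with
  | zero =>
    refine ⟨?_, fun q x x' hx => ?_⟩
    · rintro ⟨q, x⟩ c hc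
      by_cases hq : q < 0
      · have hlt : ∀ᶠ p : ℝ × ℝ in 𝓝 (q, x), p.1 < 0 :=
          continuous_fst.continuousAt.eventually (gt_mem_nhds hq)
        have hγ : ∀ᶠ p : ℝ × ℝ in 𝓝 (q, x), c < γ p.2 := by
          refine (h.cont.comp continuous_snd).continuousAt.eventually (lt_mem_nhds ?_)
          simpa [Function.uncurry, valueIter, hq] using hc
        filter_upwards [hlt, hγ] with p hp hp'
        simpa [Function.uncurry, valueIter, hp] using hp'
      · simp [Function.uncurry, valueIter, hq] at hc
    · simp only [valueIter]
      split_ifs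
      · exact h.mono hx
      · exact le_rfl
  | succ n ih => exact ih.bellman

theorem valueIter_monotone (h : IsModel μ γ B_L B_U M) (q x : ℝ) :
    Monotone fun n => valueIter μ γ M n q x := by
  refine monotone_nat_of_le_succ fun n => ?_
  induction n generalizing q x with
  | zero =>
    by_cases hq : q < 0
    · rw [h.valueIter_of_neg 0 q x hq, h.valueIter_of_neg 1 q x hq]
    · simp [valueIter, hq]
  | succ n ih => exact bellman_mono ih q x

/-- Each delivery lowers `q` by at least `B_L`, so from `q < n * B_L` the query has passed after `n`
steps and further iterations change nothing. -/
theorem valueIter_succ_eq (h : IsModel μ γ B_L B_U M) (n : ℕ) :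
    ∀ q x, q < n * B_L → valueIter μ γ M (n + 1) q x = valueIter μ γ M n q x := by
  induction n with
  | zero =>
    intro q x hq
    rw [Nat.cast_zero, zero_mul] at hq
    rw [h.valueIter_of_neg 1 q x hq, h.valueIter_of_neg 0 q x hq]
  | succ n ih =>
    intro q x hq
    push_cast at hq
    refine biInf_congr fun w hw => h.requestCost_congr ih ?_ x
    linarith [hw.1]

theorem value_eq_valueIter (h : IsModel μ γ B_L B_U M) (n : ℕ) (q x : ℝ) (hq : q < n * B_L) :
    value μ γ M q x = valueIter μ γ M n q x := by
  refine le_antisymm (iSup_le fun m => ?_) (le_iSup (fun m => valueIter μ γ M m q x) n)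
  rcases le_total m n with hmn | hnm
  · exact h.valueIter_monotone q x hmn
  · refine le_of_eq ?_
    induction m, hnm using Nat.le_induction with
    | base => rfl
    | succ m hm ih =>
      rw [h.valueIter_succ_eq m q x (hq.trans_le ?_), ih]
      have := h.pos
      gcongr

theorem isRegular_value (h : IsModel μ γ B_L B_U M) : IsRegular (value μ γ M) where
  lsc := by
    have := lowerSemicontinuous_iSup fun n => (h.isRegular_valueIter n).lsc
    convert this using 1
    ext p
    rfl
  mono q _ _ hx := iSup_mono fun n => (h.isRegular_valueIter n).mono q hx

theorem value_of_neg (h : IsModel μ γ B_L B_U M) (q x : ℝ) (hq : q < 0) :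
    value μ γ M q x = γ x := by
  simp [value, h.valueIter_of_neg _ q x hq]

/-- The Bellman equation. -/
theorem bellman_value (h : IsModel μ γ B_L B_U M) (q x : ℝ) :
    bellman μ M (value μ γ M) q x = value μ γ M q x := by
  obtain ⟨n, hn⟩ := exists_nat_gt (q / B_L)
  rw [div_lt_iff₀ h.pos] at hn
  have hlt : q < (n + 1 : ℕ) * B_L := by push_cast; linarith [h.pos]
  rw [h.value_eq_valueIter (n + 1) q x hlt]
  refine biInf_congr fun w hw => h.requestCost_congr (h.value_eq_valueIter n) ?_ x
  linarith [hw.1, h.pos]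

theorem value_le_requestCost (h : IsModel μ γ B_L B_U M) {w : ℝ} (hw : w ∈ Set.Icc 0 M)
    (q x : ℝ) : value μ γ M q x ≤ requestCost μ (value μ γ M) (q - w) x :=
  (h.bellman_value q x).symm.trans_le (bellman_le hw q x)

theorem requestCost_value_of_lt (h : IsModel μ γ B_L B_U M) {r : ℝ} (hr : r < B_L) (x : ℝ) :
    requestCost μ (value μ γ M) r x = γ x :=
  h.requestCost_of_lt h.value_of_neg hr x

theorem value_of_lt (h : IsModel μ γ B_L B_U M) {q : ℝ} (hq : q < B_L) (x : ℝ) :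
    value μ γ M q x = γ x := by
  rw [← h.bellman_value, h.bellman_of_lt h.value_of_neg hq]

/-! ### Measurable optimal waiting times -/

/-- There is a measurable selection of optimal waiting times. -/
theorem exists_measurable_optimal (h : IsModel μ γ B_L B_U M) :
    ∃ s : ℝ × ℝ → ℝ, Measurable s ∧ ∀ p, s p ∈ Set.Icc 0 M ∧
      requestCost μ (value μ γ M) (p.1 - s p) p.2 = value μ γ M p.1 p.2 := by
  have hcont : Continuous fun p : (ℝ × ℝ) × ℝ => (p.1.1 - p.2, p.1.2) := by fun_prop
  set F : (ℝ × ℝ) × ℝ → ℝ≥0∞ := fun p => requestCost μ (value μ γ M) (p.1.1 - p.2) p.1.2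
  have hF : LowerSemicontinuous F := (h.isRegular_value.requestCost (μ := μ)).lsc.comp hcont
  have hFp (p : ℝ × ℝ) : LowerSemicontinuous fun w => F (p, w) :=
    hF.comp (by fun_prop : Continuous fun w : ℝ => (p, w))
  set S : ℝ × ℝ → Set ℝ := fun p => {w ∈ Set.Icc 0 M | F (p, w) ≤ value μ γ M p.1 p.2}
  have hS (p : ℝ × ℝ) : IsCompact (S p) := by
    refine isCompact_Icc.inter_right ?_
    exact (hFp p).isClosed_preimage (value μ γ M p.1 p.2)
  have hne (p : ℝ × ℝ) : (S p).Nonempty := by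
    obtain ⟨w, hw, hmin⟩ := h.isRegular_value.exists_eq_bellman h.bound_nonneg (μ := μ) p.1 p.2
    exact ⟨w, hw, (hmin.trans (h.bellman_value p.1 p.2)).le⟩
  have hmem (p : ℝ × ℝ) : sInf (S p) ∈ S p := (hS p).sInf_mem (hne p)
  refine ⟨fun p => sInf (S p), ?_, fun p => ⟨(hmem p).1, le_antisymm (hmem p).2 ?_⟩⟩
  -- The selection is the smallest minimizer. It is at most `c` iff the infimum over waits up to `c`
  -- already reaches `value`, which compares two measurable functions.
  · refine measurable_of_Iic fun c => ?_
    rcases lt_or_ge c 0 with hc | hc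
    · convert MeasurableSet.empty
      ext p
      simpa using hc.trans_le (hmem p).1.1
    have hK : IsCompact (Set.Icc 0 (min c M)) := isCompact_Icc
    have hKne : (Set.Icc 0 (min c M)).Nonempty := Set.nonempty_Icc.2 (le_min hc h.bound_nonneg)
    have heq : (fun p => sInf (S p)) ⁻¹' Set.Iic c =
        {p | (⨅ w ∈ Set.Icc 0 (min c M), F (p, w)) ≤ value μ γ M p.1 p.2} := by
      ext p
      constructor
      · intro hp
        have hle : sInf (S p) ∈ Set.Icc 0 (min c M) := ⟨(hmem p).1.1, le_min hp (hmem p).1.2⟩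
        exact (biInf_le (fun w => F (p, w)) hle).trans (hmem p).2
      · intro hp
        obtain ⟨w, hw, hmin⟩ := exists_eq_biInf_of_isCompact hK hKne (hFp p)
        have hwS : w ∈ S p := ⟨⟨hw.1, hw.2.trans (min_le_right _ _)⟩, hmin.trans_le hp⟩
        exact (csInf_le (hS p).bddBelow hwS).trans (hw.2.trans (min_le_left _ _))
    rw [heq]
    exact measurableSet_le (lowerSemicontinuous_biInf_of_isCompact hK hF).measurable
      h.isRegular_value.lsc.measurable
  · exact h.value_le_requestCost (hmem p).1 p.1 p.2

end IsModel

/-! ### Far from the query -/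

/-- Least expected penalty of a request at least `B_U` before the query. -/
def farValue (μ : Measure ℝ) (γ : ℝ → ℝ≥0∞) (B_U M : ℝ) : ℝ≥0∞ :=
  ⨅ r ∈ Set.Icc B_U (2 * B_U), requestCost μ (value μ γ M) r r

/-- `z` takes an optimal decision at every delivery point before the query. -/
def BellmanOptimal (μ : Measure ℝ) (γ : ℝ → ℝ≥0∞) (M : ℝ) (z : ℝ → ℝ → ℝ) : Prop :=
  ∀ y q, 0 ≤ y → 0 < q →
    requestCost μ (value μ γ M) (q - z y q) (q + y) = value μ γ M q (q + y)

namespace IsModel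

variable {μ : Measure ℝ} {γ : ℝ → ℝ≥0∞} {B_L B_U M : ℝ}

theorem exists_eq_farValue (h : IsModel μ γ B_L B_U M) :
    ∃ β ∈ Set.Icc B_U (2 * B_U),
      requestCost μ (value μ γ M) β β = farValue μ γ B_U M := by
  have hcont : Continuous fun r : ℝ => (r, r) := by fun_prop
  exact exists_eq_biInf_of_isCompact isCompact_Icc
    (Set.nonempty_Icc.2 (by linarith [h.upper_pos]))
    ((h.isRegular_value.requestCost (μ := μ)).lsc.comp hcont)

theorem requestCost_of_le (h : IsModel μ γ B_L B_U M) (U : ℝ → ℝ → ℝ≥0∞) {r x : ℝ}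
    (hr : B_U ≤ r) (hx : r ≤ x) : requestCost μ U r x = ∫⁻ y, U (r - y) r ∂μ := by
  refine lintegral_congr_ae ?_
  filter_upwards [h.supp] with y hy
  rw [if_pos (hy.2.trans hr), min_eq_right hx]

/-- A request less than `B_U` before the query is improved by an earlier one. -/
theorem requestCost_add_le (h : IsModel μ γ B_L B_U M) {r x : ℝ} (hr : 0 ≤ r)
    (hx : r + B_U ≤ x) :
    requestCost μ (value μ γ M) (r + B_U) (r + B_U) ≤ requestCost μ (value μ γ M) r x := by
  have := h.prob
  rw [h.requestCost_of_le _ (by linarith) le_rfl]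
  calc ∫⁻ y, value μ γ M (r + B_U - y) (r + B_U) ∂μ
      ≤ ∫⁻ _, requestCost μ (value μ γ M) r (r + B_U) ∂μ := by
        refine lintegral_mono_ae ?_
        filter_upwards [h.supp] with y hy
        -- After delivery with delay `y`, waiting `B_U - y` leads to a request exactly `r` before
        -- the query, whatever `y` was.
        have hw : B_U - y ∈ Set.Icc 0 M :=
          ⟨by linarith [hy.2], by linarith [hy.1, h.pos, h.le_bound, h.upper_pos]⟩
        refine (h.value_le_requestCost hw _ _).trans_eq ?_
        congr 1
        ring
    _ = requestCost μ (value μ γ M) r (r + B_U) := by simp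
    _ ≤ _ := h.isRegular_value.requestCost.mono r hx

theorem farValue_le_requestCost_of_lt (h : IsModel μ γ B_L B_U M) {r x : ℝ} (hr : r < B_U)
    (hx : 2 * B_U ≤ x) : farValue μ γ B_U M ≤ requestCost μ (value μ γ M) r x := by
  have hpos := h.upper_pos
  have key (r : ℝ) (hr0 : 0 ≤ r) (hr : r < B_U) :
      farValue μ γ B_U M ≤ requestCost μ (value μ γ M) r x := by
    refine le_trans ?_ (h.requestCost_add_le hr0 (by linarith : r + B_U ≤ x))
    have hmem : r + B_U ∈ Set.Icc B_U (2 * B_U) := ⟨by linarith, by linarith⟩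
    exact biInf_le (fun r => requestCost μ (value μ γ M) r r) hmem
  rcases le_or_gt 0 r with hr0 | hr0
  · exact key r hr0 hr
  -- A request after the query has the same cost as one at the query: neither is delivered in time.
  · have h0 := key 0 le_rfl hpos
    rwa [h.requestCost_value_of_lt h.pos, ← h.requestCost_value_of_lt (hr0.trans h.pos)] at h0

/-- The two bounds need each other: a request further away than `2 * B_U` is delivered with at least
`B_U` left and age at least `2 * B_U`, and every wait from there ends in a request covered by the
first bound or by `farValue_le_requestCost_of_lt`. The induction on `n` uses that a delivery
shortens `q` by at least `B_L`. -/
theorem farValue_le (h : IsModel μ γ B_L B_U M) (n : ℕ) :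
    ∀ q, q < n * B_L →
      (∀ x, B_U ≤ q → q ≤ x → farValue μ γ B_U M ≤ requestCost μ (value μ γ M) q x) ∧
      ∀ x, B_U ≤ q → q ≤ x → 2 * B_U ≤ x → farValue μ γ B_U M ≤ value μ γ M q x := by
  have := h.prob
  have hpos := h.upper_pos
  induction n with
  | zero =>
    intro q hq
    rw [Nat.cast_zero, zero_mul] at hq
    exact ⟨fun x hx => by linarith, fun x hx => by linarith⟩
  | succ n ih =>
    have hreq (q : ℝ) (hq : q < (n + 1 : ℕ) * B_L) (x : ℝ) (hBq : B_U ≤ q) (hqx : q ≤ x) :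
        farValue μ γ B_U M ≤ requestCost μ (value μ γ M) q x := by
      push_cast at hq
      rw [h.requestCost_of_le _ hBq hqx]
      rcases le_or_gt q (2 * B_U) with h2 | h2
      · rw [← h.requestCost_of_le _ hBq le_rfl]
        have hmem : q ∈ Set.Icc B_U (2 * B_U) := ⟨hBq, h2⟩
        exact biInf_le (fun r => requestCost μ (value μ γ M) r r) hmem
      · calc farValue μ γ B_U M = ∫⁻ _, farValue μ γ B_U M ∂μ := by simp
          _ ≤ _ := by
            refine lintegral_mono_ae ?_
            filter_upwards [h.supp] with y hy
            exact (ih (q - y) (by linarith [hy.1])).2 q (by linarith [hy.2])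
              (by linarith [hy.1, h.pos]) h2.le
    refine fun q hq => ⟨hreq q hq, fun x hBq hqx h2x => ?_⟩
    rw [← h.bellman_value]
    refine le_iInf₂ fun w hw => ?_
    rcases lt_or_ge (q - w) B_U with hlt | hge
    · exact h.farValue_le_requestCost_of_lt hlt h2x
    · exact hreq _ (by linarith [hw.1]) x hge (by linarith [hw.1])

theorem farValue_le_requestCost (h : IsModel μ γ B_L B_U M) {r x : ℝ} (hr : B_U ≤ r)
    (hx : r ≤ x) : farValue μ γ B_U M ≤ requestCost μ (value μ γ M) r x := by
  obtain ⟨n, hn⟩ := exists_nat_gt (r / B_L)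
  exact (h.farValue_le n r ((div_lt_iff₀ h.pos).1 hn)).1 x hr hx

theorem value_le_farValue (h : IsModel μ γ B_L B_U M) (n : ℕ) :
    ∀ q x, q < n * B_L → 2 * B_U ≤ q → q ≤ x → value μ γ M q x ≤ farValue μ γ B_U M := by
  have := h.prob
  have hpos := h.upper_pos
  have hM := h.le_bound
  obtain ⟨β, hβ, hmin⟩ := h.exists_eq_farValue
  induction n with
  | zero =>
    intro q x hq
    rw [Nat.cast_zero, zero_mul] at hq
    exact fun hx => by linarith
  | succ n ih =>
    intro q x hq h2 hx
    push_cast at hq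
    rcases le_or_gt (q - β) M with hle | hgt
    · refine (h.value_le_requestCost ⟨by linarith [hβ.2], hle⟩ q x).trans_eq ?_
      rw [sub_sub_cancel, h.requestCost_of_le _ hβ.1 (by linarith [hβ.2]), ← hmin,
        h.requestCost_of_le _ hβ.1 le_rfl]
    · refine (h.value_le_requestCost ⟨le_rfl, h.bound_nonneg⟩ q x).trans ?_
      rw [sub_zero, h.requestCost_of_le _ (by linarith) hx]
      calc ∫⁻ y, value μ γ M (q - y) q ∂μ ≤ ∫⁻ _, farValue μ γ B_U M ∂μ := by
            refine lintegral_mono_ae ?_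
            filter_upwards [h.supp] with y hy
            exact ih _ _ (by linarith [hy.1]) (by linarith [hy.2, hβ.1])
              (by linarith [hy.1, h.pos])
        _ = _ := by simp

theorem value_eq_farValue (h : IsModel μ γ B_L B_U M) {q x : ℝ} (hq : 2 * B_U ≤ q)
    (hx : q ≤ x) : value μ γ M q x = farValue μ γ B_U M := by
  obtain ⟨n, hn⟩ := exists_nat_gt (q / B_L)
  rw [div_lt_iff₀ h.pos] at hn
  exact le_antisymm (h.value_le_farValue n q x hn hq hx)
    ((h.farValue_le n q hn).2 x (by linarith [h.upper_pos]) hx (hq.trans hx))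

theorem requestCost_eq_farValue (h : IsModel μ γ B_L B_U M) {r x : ℝ} (hr : 3 * B_U ≤ r)
    (hx : r ≤ x) : requestCost μ (value μ γ M) r x = farValue μ γ B_U M := by
  have := h.prob
  rw [h.requestCost_of_le _ (by linarith [h.upper_pos]) hx]
  calc ∫⁻ y, value μ γ M (r - y) r ∂μ = ∫⁻ _, farValue μ γ B_U M ∂μ := by
        refine lintegral_congr_ae ?_
        filter_upwards [h.supp] with y hy
        exact h.value_eq_farValue (by linarith [hy.2]) (by linarith [hy.1, h.pos])
    _ = _ := by simp

theorem exists_bellmanOptimal (h : IsModel μ γ B_L B_U M) :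
    ∃ β ∈ Set.Icc B_U (2 * B_U), requestCost μ (value μ γ M) β β = farValue μ γ B_U M ∧
      ∃ z : ℝ → ℝ → ℝ, Measurable (Function.uncurry z) ∧ (∀ y q, z y q ∈ Set.Icc 0 M) ∧
        (∀ y q, 0 < q → z y q ≤ q) ∧ BellmanOptimal μ γ M z ∧
        ∀ y q, 3 * B_U ≤ q → q - β ≤ M → z y q = q - β := by
  have hpos := h.upper_pos
  obtain ⟨β, hβ, hmin⟩ := h.exists_eq_farValue
  obtain ⟨s, hs, hopt⟩ := h.exists_measurable_optimal
  -- Cutting the measurable selection off at `q` loses nothing, since a request at or after the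
  -- query is useless; `max q 0` only keeps waits nonnegative for `q < 0`.
  refine ⟨β, hβ, hmin, fun y q => if 3 * B_U ≤ q ∧ q - β ≤ M then q - β
    else min (s (q, q + y)) (max q 0), ?_, ?_, ?_, ?_, ?_⟩
  · change Measurable fun p : ℝ × ℝ => if 3 * B_U ≤ p.2 ∧ p.2 - β ≤ M then p.2 - β
      else min (s (p.2, p.2 + p.1)) (max p.2 0)
    refine Measurable.ite ?_ (measurable_snd.sub_const β) ?_
    · exact (measurableSet_le measurable_const measurable_snd).inter
        (measurableSet_le (measurable_snd.sub_const β) measurable_const)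
    · have hp : Measurable fun p : ℝ × ℝ => (p.2, p.2 + p.1) := by fun_prop
      exact (hs.comp hp).min (by fun_prop)
  · intro y q
    dsimp only
    split_ifs with hq
    · exact ⟨by linarith [hβ.2, hq.1], hq.2⟩
    · exact ⟨le_min (hopt _).1.1 (le_max_right _ _), (min_le_left _ _).trans (hopt _).1.2⟩
  · intro y q hq0
    dsimp only
    split_ifs with hq
    · linarith [hβ.1]
    · exact (min_le_right _ _).trans_eq (max_eq_left hq0.le)
  · intro y q hy hq0
    dsimp only
    split_ifs with hq
    · rw [sub_sub_cancel, h.requestCost_of_le _ hβ.1 (by linarith [hβ.2, hq.1]),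
        ← h.requestCost_of_le _ hβ.1 le_rfl, hmin,
        h.value_eq_farValue (by linarith [hq.1]) (by linarith)]
    · rw [max_eq_left hq0.le, ← (hopt (q, q + y)).2]
      rcases le_total (s (q, q + y)) q with hle | hle
      · rw [min_eq_left hle]
      · rw [min_eq_right hle, sub_self, h.requestCost_value_of_lt h.pos,
          h.requestCost_value_of_lt (by simpa using by linarith [h.pos])]
  · intro y q h1 h2
    exact if_pos ⟨h1, h2⟩

end IsModel

/-! ### Sample paths -/

section Paths

variable {Ω : Type*} {Y Z : ℕ → Ω → ℝ} {B_L B_U Q : ℝ} {ω : Ω}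

/-- Age at the query if nothing is delivered after the update with index `j`. -/
def bestAge (Y Z : ℕ → Ω → ℝ) (Q : ℝ) : ℕ → Ω → ℝ
  | 0, ω => Q + Y 0 ω
  | j + 1, ω =>
    if Y (j + 1) ω ≤ Q - request Y Z (j + 1) ω then
      min (bestAge Y Z Q j ω) (Q - request Y Z (j + 1) ω)
    else bestAge Y Z Q j ω

/-- Sample paths that satisfy the constraints on the delays and on the waiting times. -/
structure IsRegularPath (Y Z : ℕ → Ω → ℝ) (B_L B_U : ℝ) (ω : Ω) : Prop where
  init : 0 ≤ Y 0 ω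
  delay : ∀ j, Y (j + 1) ω ∈ Set.Icc B_L B_U
  wait : ∀ j, 0 ≤ Z j ω

theorem delivery_succ (Y Z : ℕ → Ω → ℝ) (j : ℕ) (ω : Ω) :
    delivery Y Z (j + 1) ω = delivery Y Z j ω + Z j ω + Y (j + 1) ω := rfl

theorem request_succ (Y Z : ℕ → Ω → ℝ) (j : ℕ) (ω : Ω) :
    request Y Z (j + 1) ω = delivery Y Z j ω + Z j ω := rfl

theorem sub_delivery_succ (Y Z : ℕ → Ω → ℝ) (Q : ℝ) (j : ℕ) (ω : Ω) :
    Q - delivery Y Z (j + 1) ω = Q - request Y Z (j + 1) ω - Y (j + 1) ω := by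
  rw [delivery_succ, request_succ]
  ring

theorem request_eq (Y Z : ℕ → Ω → ℝ) (j : ℕ) (ω : Ω) :
    request Y Z j ω = delivery Y Z j ω - Y j ω := by
  cases j with
  | zero => simp [request, delivery]
  | succ j => rw [request_succ, delivery_succ]; ring

/-- Links the recursive state to the supremum in `age`: each step of the recursion adds one
candidate if it is delivered by `Q`. -/
theorem isGreatest_bestAge (Y Z : ℕ → Ω → ℝ) (ω : Ω) (hQ : 0 ≤ Q) (j : ℕ) :
    IsGreatest {r | ∃ i ≤ j, delivery Y Z i ω ≤ Q ∧ r = request Y Z i ω}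
      (Q - bestAge Y Z Q j ω) := by
  induction j with
  | zero =>
    refine ⟨⟨0, le_rfl, hQ, ?_⟩, ?_⟩
    · simp [bestAge, request]
    · rintro r ⟨i, hi, -, rfl⟩
      obtain rfl := Nat.le_zero.1 hi
      simp [bestAge, request]
  | succ j ih =>
    have hiff : delivery Y Z (j + 1) ω ≤ Q ↔ Y (j + 1) ω ≤ Q - request Y Z (j + 1) ω := by
      rw [delivery_succ, request_succ]
      exact ⟨fun _ => by linarith, fun _ => by linarith⟩
    obtain ⟨⟨i, hi, hiQ, hieq⟩, hub⟩ := ih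
    by_cases hc : delivery Y Z (j + 1) ω ≤ Q
    · simp only [bestAge, if_pos (hiff.1 hc)]
      constructor
      · rcases le_total (bestAge Y Z Q j ω) (Q - request Y Z (j + 1) ω) with hle | hle
        · exact ⟨i, by omega, hiQ, by rw [min_eq_left hle, hieq]⟩
        · exact ⟨j + 1, le_rfl, hc, by rw [min_eq_right hle]; ring⟩
      · rintro r ⟨l, hl, hlQ, rfl⟩
        rcases Nat.of_le_succ hl with hl | rfl
        · have := hub ⟨l, hl, hlQ, rfl⟩
          linarith [min_le_left (bestAge Y Z Q j ω) (Q - request Y Z (j + 1) ω)]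
        · linarith [min_le_right (bestAge Y Z Q j ω) (Q - request Y Z (j + 1) ω)]
    · simp only [bestAge, if_neg (mt hiff.2 hc)]
      refine ⟨⟨i, by omega, hiQ, hieq⟩, ?_⟩
      rintro r ⟨l, hl, hlQ, rfl⟩
      rcases Nat.of_le_succ hl with hl | rfl
      · exact hub ⟨l, hl, hlQ, rfl⟩
      · exact absurd hlQ hc

namespace IsRegularPath

theorem delay_nonneg (h : IsRegularPath Y Z B_L B_U ω) (hB : 0 < B_L) (j : ℕ) : 0 ≤ Y j ω := by
  cases j with
  | zero => exact h.init
  | succ j => exact hB.le.trans (h.delay j).1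

theorem le_delivery (h : IsRegularPath Y Z B_L B_U ω) (j : ℕ) :
    j * B_L ≤ delivery Y Z j ω := by
  induction j with
  | zero => simp [delivery]
  | succ j ih =>
    rw [delivery_succ]
    push_cast
    linarith [h.wait j, (h.delay j).1]

theorem delivery_nonneg (h : IsRegularPath Y Z B_L B_U ω) (hB : 0 < B_L) (j : ℕ) :
    0 ≤ delivery Y Z j ω :=
  (by positivity : (0 : ℝ) ≤ j * B_L).trans (h.le_delivery j)

theorem bestAge_nonneg (h : IsRegularPath Y Z B_L B_U ω) (hB : 0 < B_L) (hQ : 0 ≤ Q) (j : ℕ) :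
    0 ≤ bestAge Y Z Q j ω := by
  obtain ⟨i, -, hiQ, hieq⟩ := (isGreatest_bestAge Y Z ω hQ j).1
  rw [request_eq] at hieq
  linarith [h.delay_nonneg hB i]

/-- Update `i` is delivered no earlier than `i * B_L`, so updates beyond `j` arrive after `Q`. -/
theorem age_eq_bestAge (h : IsRegularPath Y Z B_L B_U ω) (hB : 0 < B_L) (hQ : 0 ≤ Q) {j : ℕ}
    (hj : Q < j * B_L) : age Y Z Q ω = bestAge Y Z Q j ω := by
  have hset : {r | ∃ i, delivery Y Z i ω ≤ Q ∧ r = request Y Z i ω} =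
      {r | ∃ i ≤ j, delivery Y Z i ω ≤ Q ∧ r = request Y Z i ω} := by
    ext r
    constructor
    · rintro ⟨i, hi, hr⟩
      refine ⟨i, ?_, hi, hr⟩
      by_contra! hlt
      have : (j : ℝ) * B_L ≤ i * B_L := by gcongr
      linarith [h.le_delivery i]
    · rintro ⟨i, -, hi⟩
      exact ⟨i, hi⟩
  rw [age, hset, (isGreatest_bestAge Y Z ω hQ j).csSup_eq, sub_sub_cancel]

/-- Updates are requested in order, so the latest delivery is the freshest. Before the query the
state is therefore `(q, q + y)`, the form used in `BellmanOptimal`. -/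
theorem bestAge_of_delivery_le (h : IsRegularPath Y Z B_L B_U ω) (hB : 0 < B_L) (j : ℕ)
    (hj : delivery Y Z j ω ≤ Q) :
    bestAge Y Z Q j ω = Q - delivery Y Z j ω + Y j ω := by
  induction j with
  | zero => simp [bestAge, delivery]
  | succ j ih =>
    rw [delivery_succ] at hj
    have hD : delivery Y Z j ω ≤ Q := by
      linarith [h.wait j, h.delay_nonneg hB (j + 1)]
    have hc : Y (j + 1) ω ≤ Q - request Y Z (j + 1) ω := by
      rw [request_succ]
      linarith
    simp only [bestAge, if_pos hc]
    rw [ih hD, delivery_succ, request_succ, min_eq_right]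
    · ring
    · linarith [h.wait j, h.delay_nonneg hB j]

end IsRegularPath

/-! The state at a delivery point is determined by the history. -/

theorem measurable_history_delay (Y Z : ℕ → Ω → ℝ) {i j : ℕ} (h : i ≤ j) :
    Measurable[history Y Z j] (Y i) :=
  (comap_measurable (Y i)).mono (le_sup_left.trans (le_iSup₂_of_le i h le_rfl)) le_rfl

theorem measurable_history_wait (Y Z : ℕ → Ω → ℝ) {i j : ℕ} (h : i ≤ j) :
    Measurable[history Y Z j] (Z i) :=
  (comap_measurable (Z i)).mono (le_sup_right.trans (le_iSup₂_of_le i h le_rfl)) le_rfl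

theorem measurable_history_delivery (Y Z : ℕ → Ω → ℝ) {i j : ℕ} (h : i ≤ j) :
    Measurable[history Y Z j] (delivery Y Z i) := by
  induction i with
  | zero => exact @measurable_const _ _ _ (history Y Z j) 0
  | succ i ih =>
    exact ((ih (by omega)).add (measurable_history_wait Y Z (by omega))).add
      (measurable_history_delay Y Z h)

theorem measurable_history_request (Y Z : ℕ → Ω → ℝ) {i j : ℕ} (h : i ≤ j) :
    Measurable[history Y Z j] (request Y Z (i + 1)) :=
  (measurable_history_delivery Y Z h).add (measurable_history_wait Y Z h)

theorem measurable_history_bestAge (Y Z : ℕ → Ω → ℝ) (Q : ℝ) {i j : ℕ} (h : i ≤ j) :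
    Measurable[history Y Z j] (bestAge Y Z Q i) := by
  induction i with
  | zero => exact (measurable_history_delay Y Z h).const_add Q
  | succ i ih =>
    have hr : Measurable[history Y Z j] fun ω => Q - request Y Z (i + 1) ω :=
      (measurable_history_request Y Z (by omega : i ≤ j)).const_sub Q
    have ih' := ih (by omega)
    exact Measurable.ite (measurableSet_le (measurable_history_delay Y Z h) hr) (ih'.min hr) ih'

end Paths

/-! ### Expected continuation values along a policy -/

section CausalPolicies

variable {Ω : Type*} [MeasurableSpace Ω] {P : Measure Ω}
  {Y Z : ℕ → Ω → ℝ} {μ : Measure ℝ} {γ : ℝ → ℝ≥0∞} {B_L B_U M Q : ℝ}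

theorem history_le (hY : ∀ j, Measurable (Y j)) (hZ : ∀ j, Measurable (Z j)) (j : ℕ) :
    history Y Z j ≤ ‹MeasurableSpace Ω› :=
  iSup₂_le fun i _ => sup_le (hY i).comap_le (hZ i).comap_le

/-- Delays with common law `μ`, but arbitrary nonnegative age at the start. -/
structure IsDelaySequence (P : Measure Ω) (μ : Measure ℝ) (Y : ℕ → Ω → ℝ) : Prop where
  measurable : ∀ j, Measurable (Y j)
  law : ∀ j, P.map (Y (j + 1)) = μ
  init : ∀ᵐ ω ∂P, 0 ≤ Y 0 ω

theorem IsDelaySequence.ae_isRegularPath (hY : IsDelaySequence P μ Y) (h : IsModel μ γ B_L B_U M)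
    (hZ : IsCausal P Y M Z) : ∀ᵐ ω ∂P, IsRegularPath Y Z B_L B_U ω := by
  have hdelay : ∀ᵐ ω ∂P, ∀ j, Y (j + 1) ω ∈ Set.Icc B_L B_U := by
    refine ae_all_iff.2 fun j => ?_
    have := h.supp
    rw [← hY.law j] at this
    exact ae_of_ae_map (hY.measurable _).aemeasurable this
  filter_upwards [hY.init, hdelay] with ω h0 h1
  exact ⟨h0, h1, fun j => (hZ.mem_Icc j ω).1⟩

/-- Expected value of the state at the delivery of update `j`. -/
def stateValue (P : Measure Ω) (U : ℝ → ℝ → ℝ≥0∞) (Y Z : ℕ → Ω → ℝ) (Q : ℝ) (j : ℕ) : ℝ≥0∞ :=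
  ∫⁻ ω, U (Q - delivery Y Z j ω) (bestAge Y Z Q j ω) ∂P

/-- The next request point and the current age are functions of the history, which is independent of
the next delay; the joint law is a product and Fubini integrates that delay out. -/
theorem stateValue_succ [IsProbabilityMeasure P] (hY : IsDelaySequence P μ Y)
    (hZ : IsCausal P Y M Z)
    {U : ℝ → ℝ → ℝ≥0∞} (hU : IsRegular U) (Q : ℝ) (j : ℕ) :
    stateValue P U Y Z Q (j + 1) =
      ∫⁻ ω, requestCost μ U (Q - delivery Y Z j ω - Z j ω) (bestAge Y Z Q j ω) ∂P := by
  set X : Ω → ℝ × ℝ := fun ω => (Q - request Y Z (j + 1) ω, bestAge Y Z Q j ω)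
  have hX : Measurable[history Y Z j] X :=
    ((measurable_history_request Y Z le_rfl).const_sub Q).prodMk
      (measurable_history_bestAge Y Z Q le_rfl)
  have hX' : Measurable X := hX.mono (history_le hY.measurable hZ.measurable j) le_rfl
  have hind : IndepFun X (Y (j + 1)) P := by
    rw [IndepFun_iff_Indep]
    exact indep_of_indep_of_le_left (hZ.nonanticipating j) hX.comap_le
  have hmap := (indepFun_iff_map_prod_eq_prod_map_map hX'.aemeasurable
    (hY.measurable (j + 1)).aemeasurable).1 hind
  rw [hY.law j] at hmap
  have : IsProbabilityMeasure μ := by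
    rw [← hY.law j]
    exact Measure.isProbabilityMeasure_map (hY.measurable _).aemeasurable
  calc stateValue P U Y Z Q (j + 1)
      = ∫⁻ ω, (fun p : (ℝ × ℝ) × ℝ =>
          U (p.1.1 - p.2) (if p.2 ≤ p.1.1 then min p.1.2 p.1.1 else p.1.2))
            (X ω, Y (j + 1) ω) ∂P := by
        refine lintegral_congr fun ω => ?_
        rw [sub_delivery_succ]
        rfl
    _ = ∫⁻ p, U (p.1.1 - p.2) (if p.2 ≤ p.1.1 then min p.1.2 p.1.1 else p.1.2)
          ∂((P.map X).prod μ) := by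
        rw [← hmap, lintegral_map hU.measurable_ite (hX'.prodMk (hY.measurable _))]
    _ = ∫⁻ a, requestCost μ U a.1 a.2 ∂(P.map X) :=
        lintegral_prod _ hU.measurable_ite.aemeasurable
    _ = ∫⁻ ω, requestCost μ U (X ω).1 (X ω).2 ∂P :=
        lintegral_map (hU.requestCost.measurable_comp measurable_fst measurable_snd) hX'
    _ = _ := by
        refine lintegral_congr fun ω => ?_
        simp only [X, request_succ, sub_sub]

theorem stateValue_monotone [IsProbabilityMeasure P] (h : IsModel μ γ B_L B_U M)
    (hY : IsDelaySequence P μ Y) (hZ : IsCausal P Y M Z) (Q : ℝ) :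
    Monotone (stateValue P (value μ γ M) Y Z Q) := by
  refine monotone_nat_of_le_succ fun j => ?_
  rw [stateValue_succ hY hZ h.isRegular_value]
  exact lintegral_mono fun ω => h.value_le_requestCost (hZ.mem_Icc j ω) _ _

variable {g : ℝ → ℝ}

/-- The penalty function, made total. -/
def penalty (g : ℝ → ℝ) (x : ℝ) : ℝ≥0∞ := ENNReal.ofReal (g (max x 0))

theorem expectedPenalty_eq_stateValue (h : IsModel μ (penalty g) B_L B_U M)
    (hY : IsDelaySequence P μ Y) (hZ : IsCausal P Y M Z) (hQ : 0 ≤ Q) {j : ℕ}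
    (hj : Q < j * B_L) :
    expectedPenalty P g Y Z Q = stateValue P (value μ (penalty g) M) Y Z Q j := by
  refine lintegral_congr_ae ?_
  filter_upwards [hY.ae_isRegularPath h hZ] with ω hω
  rw [h.value_of_neg _ _ (by linarith [hω.le_delivery j]), penalty,
    max_eq_left (hω.bestAge_nonneg h.pos hQ j), hω.age_eq_bestAge h.pos hQ hj]

theorem stateValue_le_expectedPenalty [IsProbabilityMeasure P]
    (h : IsModel μ (penalty g) B_L B_U M)
    (hY : IsDelaySequence P μ Y) (hZ : IsCausal P Y M Z) (hQ : 0 ≤ Q) (j : ℕ) :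
    stateValue P (value μ (penalty g) M) Y Z Q j ≤ expectedPenalty P g Y Z Q := by
  obtain ⟨n, hn⟩ := exists_nat_gt (Q / B_L)
  rw [div_lt_iff₀ h.pos] at hn
  have hle : Q < (max n j : ℕ) * B_L := by
    refine hn.trans_le ?_
    have := h.pos
    gcongr
    exact le_max_left _ _
  rw [expectedPenalty_eq_stateValue h hY hZ hQ hle]
  exact stateValue_monotone h hY hZ Q (le_max_right _ _)

/-- If all decisions from update `i` on are optimal, then the penalty is the value at `i`. -/
theorem expectedPenalty_eq_of_optimal [IsProbabilityMeasure P]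
    (h : IsModel μ (penalty g) B_L B_U M)
    (hY : IsDelaySequence P μ Y) (hZ : IsCausal P Y M Z) (hQ : 0 ≤ Q) (i : ℕ)
    (hopt : ∀ j, i ≤ j → ∀ ω, IsRegularPath Y Z B_L B_U ω → delivery Y Z j ω < Q →
      requestCost μ (value μ (penalty g) M) (Q - delivery Y Z j ω - Z j ω)
        (Q - delivery Y Z j ω + Y j ω) =
      value μ (penalty g) M (Q - delivery Y Z j ω) (Q - delivery Y Z j ω + Y j ω)) :
    expectedPenalty P g Y Z Q = stateValue P (value μ (penalty g) M) Y Z Q i := by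
  have hconst (j : ℕ) (hij : i ≤ j) : stateValue P (value μ (penalty g) M) Y Z Q j =
      stateValue P (value μ (penalty g) M) Y Z Q i := by
    induction j, hij using Nat.le_induction with
    | base => rfl
    | succ j hj ih =>
      rw [← ih, stateValue_succ hY hZ h.isRegular_value]
      refine lintegral_congr_ae ?_
      filter_upwards [hY.ae_isRegularPath h hZ] with ω hω
      rcases lt_or_ge (delivery Y Z j ω) Q with hlt | hge
      · rw [hω.bestAge_of_delivery_le h.pos j hlt.le, hopt j hj ω hω hlt]
      -- From the query on, decisions no longer matter: both sides are the penalty of the current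
      -- state.
      · rw [h.requestCost_value_of_lt (by linarith [hω.wait j, h.pos]),
          h.value_of_lt (by linarith [h.pos])]
  obtain ⟨n, hn⟩ := exists_nat_gt (Q / B_L)
  rw [div_lt_iff₀ h.pos] at hn
  have hle : Q < (max n i : ℕ) * B_L := by
    refine hn.trans_le ?_
    have := h.pos
    gcongr
    exact le_max_left _ _
  rw [expectedPenalty_eq_stateValue h hY hZ hQ hle, hconst _ (le_max_right _ _)]

end CausalPolicies

/-! ### Policies given by feedback rules -/

section Rules

variable {Ω : Type*}

theorem ruleDelivery_eq_delivery (φ : ℕ → ℝ → ℝ → ℝ) (Y : ℕ → Ω → ℝ) (j : ℕ) :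
    ruleDelivery φ Y j = delivery Y (rulePolicy φ Y) j := by
  induction j with
  | zero => rfl
  | succ j ih =>
    funext ω
    simp only [ruleDelivery, delivery, rulePolicy, ih]

theorem rulePolicy_apply (φ : ℕ → ℝ → ℝ → ℝ) (Y : ℕ → Ω → ℝ) (j : ℕ) (ω : Ω) :
    rulePolicy φ Y j ω = φ j (Y j ω) (delivery Y (rulePolicy φ Y) j ω) := by
  rw [← ruleDelivery_eq_delivery, rulePolicy]

theorem measurable_ruleDelivery {m : MeasurableSpace Ω} {φ : ℕ → ℝ → ℝ → ℝ} {Y : ℕ → Ω → ℝ}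
    (hφ : ∀ j, Measurable (Function.uncurry (φ j))) {j : ℕ}
    (hY : ∀ i ≤ j, Measurable (Y i)) : Measurable (ruleDelivery φ Y j) := by
  induction j with
  | zero => exact measurable_const
  | succ j ih =>
    have ih' := ih fun i hi => hY i (by omega)
    exact (ih'.add ((hφ j).comp ((hY j (by omega)).prodMk ih'))).add (hY (j + 1) le_rfl)

theorem measurable_rulePolicy {m : MeasurableSpace Ω} {φ : ℕ → ℝ → ℝ → ℝ} {Y : ℕ → Ω → ℝ}
    (hφ : ∀ j, Measurable (Function.uncurry (φ j))) {j : ℕ}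
    (hY : ∀ i ≤ j, Measurable (Y i)) : Measurable (rulePolicy φ Y j) :=
  (hφ j).comp ((hY j le_rfl).prodMk (measurable_ruleDelivery hφ hY))

/-- Feedback rules give causal policies, also if the initial age is replaced by another one that
the first delay determines. -/
theorem isCausal_rulePolicy [MeasurableSpace Ω] {P : Measure Ω} {Y Y' : ℕ → Ω → ℝ} {M : ℝ}
    (hY : ∀ j, Measurable (Y j)) (hindep : iIndepFun Y P)
    (h0 : Measurable[MeasurableSpace.comap (Y 0) (borel ℝ)] (Y' 0))
    (hsucc : ∀ j, Y' (j + 1) = Y (j + 1)) {φ : ℕ → ℝ → ℝ → ℝ}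
    (hφ : ∀ j, Measurable (Function.uncurry (φ j))) (hmem : ∀ j y d, φ j y d ∈ Set.Icc 0 M) :
    IsCausal P Y' M (rulePolicy φ Y') := by
  have hY' (j : ℕ) : Measurable[MeasurableSpace.comap (Y j) (borel ℝ)] (Y' j) := by
    cases j with
    | zero => exact h0
    | succ j => rw [hsucc j]; exact comap_measurable _
  refine ⟨fun j => measurable_rulePolicy hφ fun i _ => (hY' i).mono (hY i).comap_le le_rfl,
    fun j ω => hmem _ _ _, fun j => ?_⟩
  have hpast (i : ℕ) (hi : i ≤ j) :
      Measurable[⨆ i ≤ j, MeasurableSpace.comap (Y i) (borel ℝ)] (Y' i) :=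
    (hY' i).mono (le_iSup₂_of_le i hi le_rfl) le_rfl
  have hle : history Y' (rulePolicy φ Y') j ≤
      ⨆ i ≤ j, MeasurableSpace.comap (Y i) (borel ℝ) :=
    iSup₂_le fun i hi => sup_le (hpast i hi).comap_le
      (measurable_rulePolicy hφ fun l hl => hpast l (hl.trans hi)).comap_le
  -- A feedback rule adds no randomness, so its history lies in the σ-algebra of the first delays;
  -- independence of disjoint blocks finishes.
  have hdisj : Disjoint {i : ℕ | i ≤ j} {j + 1} := by simp
  have hind := indep_iSup_of_disjoint (m := fun i => MeasurableSpace.comap (Y i) (borel ℝ))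
    (fun i => (hY i).comap_le) hindep hdisj
  rw [hsucc j]
  refine indep_of_indep_of_le_left ?_ hle
  simpa using hind

end Rules

/-! ### The next query -/

theorem nextQuery_eq {T : ℝ} (hT : 0 < T) (d : ℝ) :
    nextQuery T d = ((⌊d / T⌋₊ + 1 : ℕ) : ℝ) * T := by
  have hleast : IsLeast {k : ℕ | 1 ≤ k ∧ d < k * T} (⌊d / T⌋₊ + 1) := by
    refine ⟨⟨by omega, ?_⟩, fun k hk => ?_⟩
    · rw [← div_lt_iff₀ hT]
      exact_mod_cast Nat.lt_floor_add_one (d / T)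
    · have h := hk.2
      rw [← div_lt_iff₀ hT, ← Nat.floor_lt' (by have := hk.1; omega)] at h
      exact h
  rw [nextQuery, hleast.csInf_eq]

theorem lt_nextQuery {T : ℝ} (hT : 0 < T) (d : ℝ) : d < nextQuery T d := by
  rw [nextQuery_eq hT, ← div_lt_iff₀ hT]
  exact_mod_cast Nat.lt_floor_add_one (d / T)

theorem measurable_nextQuery {T : ℝ} (hT : 0 < T) : Measurable (nextQuery T) := by
  have : nextQuery T = fun d => ((⌊d / T⌋₊ + 1 : ℕ) : ℝ) * T := funext (nextQuery_eq hT)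
  rw [this]
  fun_prop

theorem nextQuery_cases {T : ℝ} (hT : 0 < T) {k : ℕ} {d : ℝ} (hk : d < k * T) (hd : 0 ≤ d) :
    nextQuery T d = k * T ∨ nextQuery T d + T ≤ k * T := by
  rw [nextQuery_eq hT]
  rw [← div_lt_iff₀ hT, ← Nat.floor_lt (by positivity)] at hk
  rcases (Nat.succ_le_iff.2 hk).eq_or_lt with h | h
  · left
    rw [← h]
  · right
    have : ((⌊d / T⌋₊ + 1 : ℕ) : ℝ) + 1 ≤ k := by exact_mod_cast h
    nlinarith

theorem remaining_eq {Ω : Type*} {T : ℝ} (hT : 0 < T) {Y Z : ℕ → Ω → ℝ} {j : ℕ} {ω : Ω}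
    (hd : 0 ≤ delivery Y Z j ω) :
    remaining T Y Z j ω = nextQuery T (delivery Y Z j ω) - delivery Y Z j ω := by
  rw [remaining, nextQuery_eq hT, ← natCast_floor_eq_intCast_floor (by positivity)]
  push_cast
  ring

/-! ### Optimal policies -/

section Optimal

variable {Ω : Type*} [MeasurableSpace Ω] {P : Measure Ω} {Y Y' : ℕ → Ω → ℝ} {μ : Measure ℝ}
  {g : ℝ → ℝ} {B_L B_U M Q T : ℝ} {z : ℝ → ℝ → ℝ}

/-- A delay process with the delays of `Y`, whose initial age is determined by that of `Y`. -/
structure IsRestart (P : Measure Ω) (Y Y' : ℕ → Ω → ℝ) : Prop where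
  measurable : Measurable[MeasurableSpace.comap (Y 0) (borel ℝ)] (Y' 0)
  init : ∀ᵐ ω ∂P, 0 ≤ Y' 0 ω
  succ : ∀ j, Y' (j + 1) = Y (j + 1)

theorem isRestart_withInitialAge {y : ℝ} (hy : 0 ≤ y) : IsRestart P Y (withInitialAge y Y) where
  measurable := by
    have : withInitialAge y Y 0 = fun _ => y := Function.update_self ..
    rw [this]
    exact measurable_const
  init := .of_forall fun ω => by simpa [withInitialAge] using hy
  succ j := Function.update_of_ne (by simp) _ _

theorem isRestart_self (h : ∀ᵐ ω ∂P, 0 ≤ Y 0 ω) : IsRestart P Y Y :=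
  ⟨comap_measurable _, h, fun _ => rfl⟩

/-- Independent delays with common law `μ`. -/
structure IsIndepDelay (P : Measure Ω) (μ : Measure ℝ) (Y : ℕ → Ω → ℝ) : Prop where
  measurable : ∀ j, Measurable (Y j)
  indep : iIndepFun Y P
  law : ∀ j, P.map (Y j) = μ

theorem IsRestart.isDelaySequence (hR : IsRestart P Y Y') (hY : IsIndepDelay P μ Y) :
    IsDelaySequence P μ Y' where
  measurable j := by
    cases j with
    | zero => exact hR.measurable.mono (hY.measurable 0).comap_le le_rfl
    | succ j => rw [hR.succ]; exact hY.measurable _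
  law j := by rw [hR.succ, hY.law]
  init := hR.init

theorem IsRestart.isCausal_singleQueryPolicy (hR : IsRestart P Y Y') (hY : IsIndepDelay P μ Y)
    (hz : Measurable (Function.uncurry z)) (hmem : ∀ y q, z y q ∈ Set.Icc 0 M) (Q : ℝ) :
    IsCausal P Y' M (singleQueryPolicy z Q Y') := by
  refine isCausal_rulePolicy hY.measurable hY.indep hR.measurable hR.succ (fun _ => ?_)
    fun _ _ _ => hmem _ _
  exact hz.comp (measurable_fst.prodMk (measurable_snd.const_sub Q))

theorem IsIndepDelay.ae_nonneg (hY : IsIndepDelay P μ Y) (h : IsModel μ (penalty g) B_L B_U M) :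
    ∀ᵐ ω ∂P, 0 ≤ Y 0 ω := by
  have hs := h.supp
  rw [← hY.law 0] at hs
  filter_upwards [ae_of_ae_map (hY.measurable 0).aemeasurable hs] with ω hω
  exact h.pos.le.trans hω.1

theorem isCausal_periodicPolicy (hY : IsIndepDelay P μ Y)
    (hz : Measurable (Function.uncurry z)) (hmem : ∀ y q, z y q ∈ Set.Icc 0 M) (hT : 0 < T) :
    IsCausal P Y M (periodicPolicy z T Y) := by
  refine isCausal_rulePolicy hY.measurable hY.indep (comap_measurable _) (fun _ => rfl)
    (fun _ => ?_) fun _ _ _ => hmem _ _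
  have hn := measurable_nextQuery hT
  exact hz.comp (measurable_fst.prodMk ((hn.comp measurable_snd).sub measurable_snd))

theorem average_const (c : ℝ≥0∞) {n : ℕ} (hn : n ≠ 0) :
    (∑ _k ∈ Finset.Icc 1 n, c) / (n : ℝ≥0∞) = c := by
  rw [Finset.sum_const, Nat.card_Icc, Nat.add_sub_cancel, nsmul_eq_mul, mul_comm]
  exact ENNReal.mul_div_cancel_right (by exact_mod_cast hn) (ENNReal.natCast_ne_top n)

theorem queryAverage_eq_of_forall {Z : ℕ → Ω → ℝ} {c : ℝ≥0∞}
    (hc : ∀ k : ℕ, 1 ≤ k → expectedPenalty P g Y Z (k * T) = c) :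
    queryAverage P g Y Z T = c := by
  have : (fun n : ℕ => (∑ k ∈ Finset.Icc 1 n, expectedPenalty P g Y Z (k * T)) / (n : ℝ≥0∞))
      =ᶠ[atTop] fun _ => c := by
    -- The term at `n = 0` is the default `0 / 0 = 0`, so equality holds only eventually.
    filter_upwards [eventually_ne_atTop 0] with n hn
    rw [Finset.sum_congr rfl fun k hk => hc k (Finset.mem_Icc.1 hk).1, average_const c hn]
  rw [queryAverage, limsup_congr this, limsup_const]

theorem le_queryAverage_of_forall {Z : ℕ → Ω → ℝ} {c : ℝ≥0∞}
    (hc : ∀ k : ℕ, 1 ≤ k → c ≤ expectedPenalty P g Y Z (k * T)) :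
    c ≤ queryAverage P g Y Z T := by
  calc c = limsup (fun _ : ℕ => c) atTop := (limsup_const c).symm
    _ ≤ _ := by
      refine limsup_le_limsup ?_
      filter_upwards [eventually_ne_atTop 0] with n hn
      rw [← average_const c hn]
      gcongr with k hk
      exact hc k (Finset.mem_Icc.1 hk).1

theorem isStationaryDeterministic_periodicPolicy (hY : IsIndepDelay P μ Y)
    (h : IsModel μ (penalty g) B_L B_U M) (hz : Measurable (Function.uncurry z))
    (hmem : ∀ y q, z y q ∈ Set.Icc 0 M) (hT : 0 < T) :
    IsStationaryDeterministic P Y M T (periodicPolicy z T Y) z := by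
  refine ⟨hz, hmem, ?_⟩
  filter_upwards [((isRestart_self (hY.ae_nonneg h)).isDelaySequence hY).ae_isRegularPath h
    (isCausal_periodicPolicy hY hz hmem hT)] with ω hω j
  rw [remaining_eq hT (hω.delivery_nonneg h.pos j)]
  exact rulePolicy_apply _ _ _ _

variable [IsProbabilityMeasure P]

theorem IsRestart.expectedPenalty_singleQueryPolicy (hR : IsRestart P Y Y')
    (hY : IsIndepDelay P μ Y) (h : IsModel μ (penalty g) B_L B_U M)
    (hz : Measurable (Function.uncurry z)) (hmem : ∀ y q, z y q ∈ Set.Icc 0 M)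
    (hopt : BellmanOptimal μ (penalty g) M z) (hQ : 0 ≤ Q) :
    expectedPenalty P g Y' (singleQueryPolicy z Q Y') Q =
      ∫⁻ ω, value μ (penalty g) M Q (Q + Y' 0 ω) ∂P := by
  rw [expectedPenalty_eq_of_optimal h (hR.isDelaySequence hY)
    (hR.isCausal_singleQueryPolicy hY hz hmem Q) hQ 0]
  · simp [stateValue, delivery, bestAge]
  · intro j _ ω hω hlt
    rw [singleQueryPolicy, rulePolicy_apply]
    exact hopt _ _ (hω.delay_nonneg h.pos j) (sub_pos.2 hlt)

/-- The upper bound comes from a measurable Bellman-optimal rule, the lower one from monotonicity of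
`stateValue` starting at index `0`. -/
theorem IsRestart.singleQueryOpt_eq (hR : IsRestart P Y Y') (hY : IsIndepDelay P μ Y)
    (h : IsModel μ (penalty g) B_L B_U M) (hQ : 0 ≤ Q) :
    singleQueryOpt P g Y' M Q = ∫⁻ ω, value μ (penalty g) M Q (Q + Y' 0 ω) ∂P := by
  obtain ⟨β, -, -, z, hz, hmem, -, hopt, -⟩ := h.exists_bellmanOptimal
  refine le_antisymm ?_ (le_iInf₂ fun Z hZ => ?_)
  · rw [← hR.expectedPenalty_singleQueryPolicy hY h hz hmem hopt hQ]
    exact iInf₂_le _ (hR.isCausal_singleQueryPolicy hY hz hmem Q)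
  · refine le_trans (le_of_eq ?_)
      (stateValue_le_expectedPenalty h (hR.isDelaySequence hY) hZ hQ 0)
    simp [stateValue, delivery, bestAge]

theorem singleQueryOpt_withInitialAge (hY : IsIndepDelay P μ Y)
    (h : IsModel μ (penalty g) B_L B_U M) (hQ : 0 ≤ Q) {y : ℝ} (hy : 0 ≤ y) :
    singleQueryOpt P g (withInitialAge y Y) M Q = value μ (penalty g) M Q (Q + y) := by
  rw [(isRestart_withInitialAge hy).singleQueryOpt_eq hY h hQ]
  simp [withInitialAge]

theorem singleQueryOpt_eq_farValue (hY : IsIndepDelay P μ Y)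
    (h : IsModel μ (penalty g) B_L B_U M) (hQ : 2 * B_U ≤ Q) :
    singleQueryOpt P g Y M Q = farValue μ (penalty g) B_U M := by
  have h0 := hY.ae_nonneg h
  rw [(isRestart_self h0).singleQueryOpt_eq hY h (by linarith [h.upper_pos])]
  calc ∫⁻ ω, value μ (penalty g) M Q (Q + Y 0 ω) ∂P
      = ∫⁻ _, farValue μ (penalty g) B_U M ∂P := by
        refine lintegral_congr_ae ?_
        filter_upwards [h0] with ω hω
        exact h.value_eq_farValue hQ (by linarith)
    _ = _ := by simp

/-- The value after a request at the start does not exceed the cost of any causal continuation. -/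
theorem IsRestart.requestCost_le_expectedPenalty {y w : ℝ} (hR : IsRestart P Y Y')
    (hY : IsIndepDelay P μ Y) (h : IsModel μ (penalty g) B_L B_U M) {Z : ℕ → Ω → ℝ}
    (hZ : IsCausal P Y' M Z) (hQ : 0 ≤ Q) (hy : ∀ ω, Y' 0 ω = y) (hw : ∀ ω, Z 0 ω = w) :
    requestCost μ (value μ (penalty g) M) (Q - w) (Q + y) ≤ expectedPenalty P g Y' Z Q := by
  refine le_trans (le_of_eq ?_)
    (stateValue_le_expectedPenalty h (hR.isDelaySequence hY) hZ hQ 1)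
  rw [stateValue_succ (hR.isDelaySequence hY) hZ h.isRegular_value]
  simp [delivery, bestAge, hy, hw]

/-- Optimality of the whole continuation forces optimality of its first decision: the cost of that
decision followed by optimal play is at most the penalty of `z`, which equals `value`. -/
theorem IsBorderPointPolicy.bellmanOptimal (hz : IsBorderPointPolicy P g Y B_L B_U M z)
    (hY : IsIndepDelay P μ Y) (h : IsModel μ (penalty g) B_L B_U M) :
    BellmanOptimal μ (penalty g) M z := by
  intro y q hy hq
  have hR : IsRestart P Y (withInitialAge y Y) := isRestart_withInitialAge hy
  refine le_antisymm ?_ (h.value_le_requestCost (hz.mem_Icc y q) _ _)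
  rw [← singleQueryOpt_withInitialAge hY h hq.le hy, ← hz.optimal y q hy hq]
  refine hR.requestCost_le_expectedPenalty hY h
    (hR.isCausal_singleQueryPolicy hY hz.measurable hz.mem_Icc q) hq.le
    (fun ω => by simp [withInitialAge]) fun ω => ?_
  rw [singleQueryPolicy, rulePolicy_apply]
  simp [delivery, withInitialAge]

/-- The rule requests at once at index `0`, a decision that may be suboptimal; all later ones are
optimal, so the evaluation starts at index `1`. -/
theorem requestValue_eq (hY : IsIndepDelay P μ Y) (h : IsModel μ (penalty g) B_L B_U M)
    (hz : Measurable (Function.uncurry z)) (hmem : ∀ y q, z y q ∈ Set.Icc 0 M)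
    (hopt : BellmanOptimal μ (penalty g) M z) {r a : ℝ} (hr : 0 ≤ r) (ha : 0 ≤ a) :
    requestValue P g Y z r a = requestCost μ (value μ (penalty g) M) r (r + a) := by
  have hR : IsRestart P Y (withInitialAge a Y) := isRestart_withInitialAge ha
  have hZ : IsCausal P (withInitialAge a Y) M
      (rulePolicy (fun j y d => if j = 0 then 0 else z y (r - d)) (withInitialAge a Y)) := by
    refine isCausal_rulePolicy hY.measurable hY.indep hR.measurable hR.succ (fun j => ?_)
      fun j y d => ?_
    · by_cases hj : j = 0
      · simp only [hj, if_true]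
        exact measurable_const
      · simp only [hj, if_false]
        exact hz.comp (measurable_fst.prodMk (measurable_snd.const_sub r))
    · split_ifs
      · exact ⟨le_rfl, h.bound_nonneg⟩
      · exact hmem _ _
  rw [requestValue, expectedPenalty_eq_of_optimal h (hR.isDelaySequence hY) hZ hr 1]
  · rw [stateValue_succ (hR.isDelaySequence hY) hZ h.isRegular_value]
    simp [delivery, bestAge, rulePolicy, withInitialAge]
  · intro j hj ω hω hlt
    rw [rulePolicy_apply, if_neg (by omega)]
    exact hopt _ _ (hω.delay_nonneg h.pos j) (sub_pos.2 hlt)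

theorem exists_isBorderPointPolicy (hY : IsIndepDelay P μ Y)
    (h : IsModel μ (penalty g) B_L B_U M) :
    ∃ z : ℝ → ℝ → ℝ, IsBorderPointPolicy P g Y B_L B_U M z := by
  have hpos := h.upper_pos
  obtain ⟨β, hβ, hmin, z, hz, hmem, hle, hopt, hwait⟩ := h.exists_bellmanOptimal
  have hborder : borderDistance z B_L B_U = β := by
    rw [borderDistance, hwait _ _ le_rfl (by linarith [h.le_bound, hβ.1]), sub_sub_cancel]
  refine ⟨z, hz, hmem, fun y q _ => hle y q, fun y q hy hq => ?_, hborder ▸ hβ.1, ?_, ?_⟩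
  · rw [deliveryValue, (isRestart_withInitialAge hy).expectedPenalty_singleQueryPolicy hY h hz
      hmem hopt hq.le, (isRestart_withInitialAge hy).singleQueryOpt_eq hY h hq.le]
  · intro r a a' hr ha ha'
    rw [hborder, requestValue_eq hY h hz hmem hopt (by linarith [hβ.1]) ha,
      requestValue_eq hY h hz hmem hopt (by linarith) ha',
      h.requestCost_of_le _ hβ.1 (by linarith), ← h.requestCost_of_le _ hβ.1 le_rfl, hmin]
    exact h.farValue_le_requestCost hr (by linarith)
  · intro y q _ hq hqM
    rw [hborder] at hqM ⊢
    exact hwait y q hq.le hqM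

/-! ### Periodic queries -/

/-- The repeated policy is optimal for every single query: before the previous query no request is
postponed beyond that one, and all requests at least `3 B_U` before a query are equally good. -/
theorem expectedPenalty_periodicPolicy (hY : IsIndepDelay P μ Y)
    (h : IsModel μ (penalty g) B_L B_U M) (hz : IsBorderPointPolicy P g Y B_L B_U M z)
    (hT : 4 * B_U < T) {k : ℕ} (hk : 1 ≤ k) :
    expectedPenalty P g Y (periodicPolicy z T Y) (k * T) = singleQueryOpt P g Y M (k * T) := by
  have hpos := h.upper_pos
  have hT0 : 0 < T := by linarith
  have hopt := hz.bellmanOptimal hY h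
  have hR := isRestart_self (hY.ae_nonneg h)
  rw [hR.singleQueryOpt_eq hY h (by positivity),
    expectedPenalty_eq_of_optimal h (hR.isDelaySequence hY)
      (isCausal_periodicPolicy hY hz.measurable hz.mem_Icc hT0) (by positivity) 0]
  · simp [stateValue, delivery, bestAge]
  · intro j _ ω hω hlt
    have hy := hω.delay_nonneg h.pos j
    rw [periodicPolicy, rulePolicy_apply, ← periodicPolicy]
    have hd0 := hω.delivery_nonneg h.pos j
    set d := delivery Y (periodicPolicy z T Y) j ω
    have hnext := lt_nextQuery hT0 d
    have hle := hz.le_query (Y j ω) (nextQuery T d - d) hy (sub_pos.2 hnext)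
    have hwait := (hz.mem_Icc (Y j ω) (nextQuery T d - d)).1
    rcases nextQuery_cases hT0 hlt hd0 with heq | hfar
    · rw [heq]
      exact hopt _ _ hy (sub_pos.2 hlt)
    · rw [h.requestCost_eq_farValue (by linarith) (by linarith),
        h.value_eq_farValue (by linarith) (by linarith)]

theorem queryAverage_periodicPolicy (hY : IsIndepDelay P μ Y)
    (h : IsModel μ (penalty g) B_L B_U M) (hz : IsBorderPointPolicy P g Y B_L B_U M z)
    (hT : 4 * B_U < T) :
    queryAverage P g Y (periodicPolicy z T Y) T = farValue μ (penalty g) B_U M := by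
  refine queryAverage_eq_of_forall fun k hk => ?_
  have hpos := h.upper_pos
  have hk' : (1 : ℝ) ≤ k := by exact_mod_cast hk
  rw [expectedPenalty_periodicPolicy hY h hz hT hk, singleQueryOpt_eq_farValue hY h (by nlinarith)]

theorem periodicOpt_eq_farValue (hY : IsIndepDelay P μ Y)
    (h : IsModel μ (penalty g) B_L B_U M) (hT : 4 * B_U < T) :
    periodicOpt P g Y M T = farValue μ (penalty g) B_U M := by
  have hpos := h.upper_pos
  obtain ⟨z, hz⟩ := exists_isBorderPointPolicy hY h
  refine le_antisymm ?_ (le_iInf₂ fun Z hZ => le_queryAverage_of_forall fun k hk => ?_)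
  · rw [← queryAverage_periodicPolicy hY h hz hT]
    exact iInf₂_le _ (isCausal_periodicPolicy hY hz.measurable hz.mem_Icc (by linarith))
  · have hk' : (1 : ℝ) ≤ k := by exact_mod_cast hk
    rw [← singleQueryOpt_eq_farValue hY h (by nlinarith : 2 * B_U ≤ k * T)]
    exact iInf₂_le _ hZ

theorem isModel_map (hY : ∀ j, Measurable (Y j)) (hBL : 0 < B_L)
    (hsupp : ∀ᵐ ω ∂P, Y 0 ω ∈ Set.Icc B_L B_U) (hM : 3 * B_U ≤ M)
    (hgcont : ContinuousOn g (Set.Ici 0)) (hgmono : MonotoneOn g (Set.Ici 0)) :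
    IsModel (P.map (Y 0)) (penalty g) B_L B_U M where
  prob := Measure.isProbabilityMeasure_map (hY 0).aemeasurable
  pos := hBL
  supp := (ae_map_iff (hY 0).aemeasurable measurableSet_Icc).2 hsupp
  cont := ENNReal.continuous_ofReal.comp
    (hgcont.comp_continuous (by fun_prop) fun x => le_max_right x 0)
  mono x x' hx := ENNReal.ofReal_le_ofReal
    (hgmono (le_max_right x 0) (le_max_right x' 0) (max_le_max_right 0 hx))
  le_bound := hM

end Optimal

end PullOrWait

end

theorem corollary4 {Ω : Type*} [MeasurableSpace Ω] (P : Measure Ω) [IsProbabilityMeasure P]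
    (Y : ℕ → Ω → ℝ) (hmeas : ∀ j, Measurable (Y j)) (hindep : iIndepFun Y P)
    (hident : ∀ j, IdentDistrib (Y j) (Y 0) P P)
    (B_L B_U M T : ℝ) (hBL : 0 < B_L) (hsupp : ∀ j, ∀ᵐ ω ∂P, Y j ω ∈ Set.Icc B_L B_U)
    (hT : 4 * B_U < T) (hM : T - B_U ≤ M)
    (g : ℝ → ℝ) (hgcont : ContinuousOn g (Set.Ici 0)) (hgmono : MonotoneOn g (Set.Ici 0))
    (hgnonneg : ∀ x, 0 ≤ x → 0 ≤ g x) :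
    (∃ z : ℝ → ℝ → ℝ, PullOrWait.IsBorderPointPolicy P g Y B_L B_U M z) ∧
    ∀ z : ℝ → ℝ → ℝ, PullOrWait.IsBorderPointPolicy P g Y B_L B_U M z →
      -- `z` solves every single query problem
      (∀ Q : ℝ, 0 < Q →
        PullOrWait.IsCausal P Y M (PullOrWait.singleQueryPolicy z Q Y) ∧
        PullOrWait.expectedPenalty P g Y (PullOrWait.singleQueryPolicy z Q Y) Q =
          PullOrWait.singleQueryOpt P g Y M Q) ∧
      -- the constructed policy is optimal for periodic queries
      PullOrWait.IsCausal P Y M (PullOrWait.periodicPolicy z T Y) ∧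
      PullOrWait.queryAverage P g Y (PullOrWait.periodicPolicy z T Y) T =
        PullOrWait.periodicOpt P g Y M T ∧
      (∀ Q : ℝ, 3 * B_U < Q →
        PullOrWait.periodicOpt P g Y M T = PullOrWait.singleQueryOpt P g Y M Q) ∧
      -- it is stationary and deterministic, with waiting times `z (Y j) (A j)`
      PullOrWait.IsStationaryDeterministic P Y M T (PullOrWait.periodicPolicy z T Y) z := by
  have hY : PullOrWait.IsIndepDelay P (P.map (Y 0)) Y :=
    ⟨hmeas, hindep, fun j => (hident j).map_eq⟩
  have hBU : 0 < B_U := by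
    obtain ⟨ω, hω⟩ := (hsupp 0).exists
    exact hBL.trans_le (hω.1.trans hω.2)
  have h : PullOrWait.IsModel (P.map (Y 0)) (PullOrWait.penalty g) B_L B_U M :=
    -- `T - B_U ≤ M` and `4 * B_U < T` give `3 * B_U ≤ M`.
    PullOrWait.isModel_map hmeas hBL (hsupp 0) (by linarith) hgcont hgmono
  have hT0 : 0 < T := by linarith
  refine ⟨PullOrWait.exists_isBorderPointPolicy hY h, fun z hz => ⟨fun Q hQ => ?_,
    PullOrWait.isCausal_periodicPolicy hY hz.measurable hz.mem_Icc hT0, ?_, fun Q hQ => ?_,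
    PullOrWait.isStationaryDeterministic_periodicPolicy hY h hz.measurable hz.mem_Icc hT0⟩⟩
  · have hR := PullOrWait.isRestart_self (hY.ae_nonneg h)
    refine ⟨hR.isCausal_singleQueryPolicy hY hz.measurable hz.mem_Icc Q, ?_⟩
    rw [hR.singleQueryOpt_eq hY h hQ.le, hR.expectedPenalty_singleQueryPolicy hY h hz.measurable
      hz.mem_Icc (hz.bellmanOptimal hY h) hQ.le]
  · rw [PullOrWait.queryAverage_periodicPolicy hY h hz hT,
      PullOrWait.periodicOpt_eq_farValue hY h hT]
  · rw [PullOrWait.periodicOpt_eq_farValue hY h hT,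
      PullOrWait.singleQueryOpt_eq_farValue hY h (by linarith)]
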